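/- Let $\mathbf{X}$ be a Euclidean space (a finite-dimensional real inner product space) with closed unit ball $B$. For $f\colon\mathbf{X}\to\mathbb{R}$ let $\partial f(x)$ denote the Clarke subdifferential, the closed convex hull of all limits $\lim_r \nabla f(x_r)$ along sequences $x_r\to x$ of points of differentiability; for $\varepsilon\ge 0$ let $\partial_\varepsilon f(x)=\mathrm{conv}\,\big(\partial f(x+\varepsilon B)\big)$ be the Goldstein subdifferential, $g_\varepsilon(x)$ its shortest vector, and $\Gamma f(x)=\inf\{\varepsilon\ge 0: |g_\varepsilon(x)|\le\varepsilon\}$ the Goldstein modulus. **Hypotheses.** Suppose $f\colon\mathbf{X}\to\mathbb{R}$ is a strong $\mathcal{C}^2$ max function at $\bar x\in\mathbf{X}$, that is: * $\bar x$ is Clarke critical and nondegenerate: $0\in\mathrm{ri}\,\partial f(\bar x)$; * $f$ grows quadratically at $\bar x$: there is $\delta>0$ with $f(x)-f(\bar x)\ge\frac{\delta}{2}|x-\bar x|^2$ for all $x$ near $\bar x$; * there are a finite set $I$ and $\mathcal{C}^2$ functions $f_i\colon\mathbf{X}\to\mathbb{R}$ ($i\in I$) with $f(x)=\max_{i\in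 I}f_i(x)$ for all $x$ near $\bar x$, the values $f_i(\bar x)$ ($i\in I$) all equal, and the gradients $\nabla f_i(\bar x)$ ($i\in I$) affinely independent. Let $\mathcal{M}$ be the active manifold of this representation, the set of all $x\in\mathbf{X}$ at which the values $f_i(x)$ ($i\in I$) are all equal. **Conclusion.** The function $f$ grows robustly relative to $\mathcal{M}$ at $\bar x$, that is: * $\mathcal{M}$ is a $\mathcal{C}^2$-smooth manifold around $\bar x\in\mathcal{M}$, and $f$ is Lipschitz on a neighborhood of $\bar x$; * $f$ grows quadratically at $\bar x$; * at every point $x\in\mathcal{M}$ near $\bar x$, $f$ is subdifferentially regular: $\lim_{t\downarrow 0}\frac1t\big(f(x+ty)-f(x)\big)=\max_{v\in\partial f(x)}\langle v,y\rangle$ for all $y\in\mathbf{X}$; * the restriction of $f$ to $\mathcal{M}$ is $\mathcal{C}^2$-smooth around $\bar x$; * $\partial f$ is upper Lipschitz relative to $\mathcal{M}$ at $\bar x$: there is $K>0$ such that $\partial f(y)\subset\partial f(x)+K|x-y|B$ for all $x,y$ near $\bar x$ with $x\in\mathcal{M}$; * the aiming condition holds: there is $\mu>0$ such that every $x$ near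 $\bar x$ has a unique nearest point $P_{\mathcal M}(x)$ in $\mathcal{M}$ and every $v\in\partial f(x)$ satisfies $\langle v,x-P_{\mathcal M}(x)\rangle\ge\mu\,d_{\mathcal M}(x)$, where $d_{\mathcal M}(x)$ is the distance from $x$ to $\mathcal{M}$. Moreover, the Goldstein modulus of $f$ grows linearly at $\bar x$: there is $\alpha>0$ such that $\Gamma f(x)\ge\alpha|x-\bar x|$ for all $x$ near $\bar x$. -/

import Mathlib

open Set Filter Topology
open scoped Gradient RealInnerProductSpace Pointwise

noncomputable section GoldsteinDefs

variable {E : Type*} [NormedAddCommGroup E] [InnerProductSpace ℝ E]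

/-- The Clarke subdifferential `∂f(x)`: the closed convex hull of all limits of gradients `∇f(x_r)`
along sequences `x_r → x` of points of differentiability of `f`. -/
def clarkeSubdiff [CompleteSpace E] (f : E → ℝ) (x : E) : Set E :=
  closure (convexHull ℝ {v : E | ∃ xs : ℕ → E, Tendsto xs atTop (𝓝 x) ∧
    (∀ r, DifferentiableAt ℝ f (xs r)) ∧ Tendsto (fun r => ∇ f (xs r)) atTop (𝓝 v)})

/-- The Goldstein subdifferential `∂_ε f(x) = conv (∂f(x + εB))`. -/
def goldsteinSubdiff [CompleteSpace E] (f : E → ℝ) (ε : ℝ) (x : E) : Set E :=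
  convexHull ℝ (⋃ z ∈ Metric.closedBall x ε, clarkeSubdiff f z)

/-- `g` is the Goldstein subgradient `g_ε(x)`: the shortest vector in `∂_ε f(x)`. -/
def IsGoldsteinSubgradient [CompleteSpace E] (f : E → ℝ) (ε : ℝ) (x g : E) : Prop :=
  g ∈ goldsteinSubdiff f ε x ∧ ∀ v ∈ goldsteinSubdiff f ε x, ‖g‖ ≤ ‖v‖

/-- The Goldstein modulus `Γf(x) = inf {ε ≥ 0 : |g_ε(x)| ≤ ε}`. -/
def goldsteinModulus [CompleteSpace E] (f : E → ℝ) (x : E) : ℝ :=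
  sInf {ε : ℝ | 0 ≤ ε ∧ ∃ g : E, IsGoldsteinSubgradient f ε x g ∧ ‖g‖ ≤ ε}

/-- The Goldstein modulus of `f` grows linearly at `xbar`. -/
def GoldsteinModulusGrowsLinearly [CompleteSpace E] (f : E → ℝ) (xbar : E) : Prop :=
  ∃ α : ℝ, 0 < α ∧ ∀ᶠ x in 𝓝 xbar, α * ‖x - xbar‖ ≤ goldsteinModulus f x

/-- `f` grows quadratically at `xbar`. -/
def GrowsQuadratically (f : E → ℝ) (xbar : E) : Prop :=
  ∃ δ : ℝ, 0 < δ ∧ ∀ᶠ x in 𝓝 xbar, δ / 2 * ‖x - xbar‖ ^ 2 ≤ f x - f xbar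

/-- `M` is a `C²`-smooth (embedded) manifold around `xbar ∈ M`: near `xbar`, it is the zero set of a
`C²` map into some `ℝᵏ` with everywhere surjective derivative. -/
def IsC2ManifoldAround (M : Set E) (xbar : E) : Prop :=
  xbar ∈ M ∧ ∃ U : Set E, IsOpen U ∧ xbar ∈ U ∧ ∃ (k : ℕ) (G : E → EuclideanSpace ℝ (Fin k)),
    ContDiffOn ℝ 2 G U ∧ (∀ x ∈ U, Function.Surjective (fderiv ℝ G x)) ∧
    M ∩ U = {x ∈ U | G x = 0}

/-- The restriction of `f` to the set `M` (a `C²` manifold around `xbar`) is `C²`-smooth around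
`xbar`: near `xbar` it agrees on `M` with a function that is `C²` on a neighbourhood of `xbar`
in the ambient space. -/
def RestrictionC2Around (f : E → ℝ) (M : Set E) (xbar : E) : Prop :=
  ∃ g : E → ℝ, ContDiffAt ℝ 2 g xbar ∧ ∀ᶠ x in 𝓝[M] xbar, f x = g x

/-- `f` is subdifferentially regular at `x`: in every direction `y`, the one-sided directional
derivative exists and equals the Clarke directional derivative `max {⟪v, y⟫ : v ∈ ∂f(x)}`. -/
def SubdiffRegularAt [CompleteSpace E] (f : E → ℝ) (x : E) : Prop :=
  ∀ y : E, ∃ d : ℝ, IsGreatest ((fun v : E => ⟪v, y⟫) '' clarkeSubdiff f x) d ∧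
    Tendsto (fun t : ℝ => 1 / t * (f (x + t • y) - f x)) (𝓝[>] 0) (𝓝 d)

/-- `∂f` is upper Lipschitz relative to `M` at `xbar`: for some `K > 0`,
`∂f(y) ⊆ ∂f(x) + K|x - y|B` for all points `x, y` near `xbar` with `x ∈ M`. -/
def SubdiffUpperLipschitz [CompleteSpace E] (f : E → ℝ) (M : Set E) (xbar : E) : Prop :=
  ∃ K : ℝ, 0 < K ∧ ∃ U ∈ 𝓝 xbar, ∀ x ∈ U, ∀ y ∈ U, x ∈ M →
    clarkeSubdiff f y ⊆ clarkeSubdiff f x + (K * ‖x - y‖) • Metric.closedBall (0 : E) 1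

/-- `p` is a nearest point to `x` in `M`. -/
def IsNearestPoint (M : Set E) (x p : E) : Prop :=
  p ∈ M ∧ ∀ q ∈ M, ‖x - p‖ ≤ ‖x - q‖

/-- The aiming condition relative to `M` at `xbar`: for some `μ > 0`, every `x` near `xbar` has a
unique nearest point `P_M(x)` in `M`, and `⟪v, x - P_M(x)⟫ ≥ μ d_M(x)` for all `v ∈ ∂f(x)`. -/
def AimingCondition [CompleteSpace E] (f : E → ℝ) (M : Set E) (xbar : E) : Prop :=
  ∃ μ : ℝ, 0 < μ ∧ ∀ᶠ x in 𝓝 xbar, (∃! p : E, IsNearestPoint M x p) ∧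
    ∀ p : E, IsNearestPoint M x p → ∀ v ∈ clarkeSubdiff f x,
      μ * Metric.infDist x M ≤ ⟪v, x - p⟫

/-- `f` grows robustly relative to `M` at `xbar`. All the conditions are local around `xbar`. -/
structure GrowsRobustly [CompleteSpace E] (f : E → ℝ) (M : Set E) (xbar : E) : Prop where
  manifold : IsC2ManifoldAround M xbar
  lipschitz_near : ∃ (L : NNReal), ∃ U ∈ 𝓝 xbar, LipschitzOnWith L f U
  quadratic_growth : GrowsQuadratically f xbar
  regular : ∀ᶠ x in 𝓝[M] xbar, SubdiffRegularAt f x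
  restriction_C2 : RestrictionC2Around f M xbar
  upper_lipschitz : SubdiffUpperLipschitz f M xbar
  aiming : AimingCondition f M xbar

/-- `f` is a strong `C²` max function at `xbar`, with the representation `f = max_i fi i` near
`xbar`. -/
structure IsStrongC2Max [CompleteSpace E] {ι : Type*} (f : E → ℝ) (fi : ι → E → ℝ)
    (xbar : E) : Prop where
  /-- `xbar` is Clarke critical and nondegenerate: `0 ∈ ri ∂f(xbar)` -/
  nondegenerate : (0 : E) ∈ intrinsicInterior ℝ (clarkeSubdiff f xbar)
  quadratic_growth : GrowsQuadratically f xbar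
  finite : Finite ι
  smooth : ∀ i, ContDiff ℝ 2 (fi i)
  eq_max : ∀ᶠ x in 𝓝 xbar, IsGreatest (range fun i => fi i x) (f x)
  values_eq : ∀ i j, fi i xbar = fi j xbar
  affineIndependent : AffineIndependent ℝ (fun i => ∇ (fi i) xbar)

/-- The active manifold: the set of points where the values `fi i x` are all equal. -/
def activeManifold {ι : Type*} (fi : ι → E → ℝ) : Set E :=
  {x : E | ∀ i j, fi i x = fi j x}

end GoldsteinDefs

/-!
All conditions are local, and near `xbar` the Clarke subdifferential of `f` at `x` is the convex
hull of the gradients at `x` of the active functions (`clarkeSubdiff_eq_convexHull`): where `f` is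
differentiable it shares its gradient with each active function, and, by affine independence, from
any point one can move in a direction that makes a prescribed active function the only active one.
Nondegeneracy then says that `0` is a combination of the gradients at `xbar` with positive weights
`l i` (`AffineIndependent.exists_pos_weights`). On the active manifold all functions are active, so
that regularity is the derivative of a finite maximum, and the upper Lipschitz property compares
combinations of gradients at two points with the same weights.

The differences of the `fi` form a submersion at `xbar` whose zero set is the active manifold.
By metric regularity (`exists_mem_activeManifold_near`), the distance from `x` to the manifold is at
most a multiple of the spread of the values `fi i x`. This one fact replaces normal vectors and
Lagrange multipliers throughout.

* Nearest points are unique because the midpoint of two of them, which is strictly closer to `x`,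
  has spread only quadratic in their distance.
* Aiming holds because the `l`-average of the increments `fi i x - fi i p` from the nearest point
  `p` is of smaller order than `‖x - p‖` while their spread is not; so the largest increment, which is
  `f x - f p` and approximates `⟪v, x - p⟫`, is at least a multiple of `‖x - p‖`.
* For the Goldstein modulus, a Goldstein subgradient of norm at most `ε` at `x` is, up to `O(ε)`, a
  combination of the gradients `∇ (fi i) x` with weights close to `l`, hence positive. Therefore
  every function is active somewhere within `ε` of `x`, and `x` lies within `O(ε)` of a point `p` of the
  manifold at which some subgradient is `O(ε)`. On the manifold, quadratic growth and the
  trapezoid rule for `C²` functions give a lower bound of order `‖p - xbar‖` on the norm of all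
  subgradients (`LocalEstimates.exists_le_norm_sum_smul_gradient`), so `‖x - xbar‖` is `O(ε)`.
-/

/-! ### Gradients, the trapezoid rule, and metric regularity -/

section Calculus

variable {E : Type*} [NormedAddCommGroup E] [InnerProductSpace ℝ E] [CompleteSpace E]

theorem inner_gradient_eq_fderiv (h : E → ℝ) (x w : E) : ⟪∇ h x, w⟫ = fderiv ℝ h x w := by
  simp [gradient]

theorem norm_gradient_sub (h : E → ℝ) (x y : E) :
    ‖∇ h x - ∇ h y‖ = ‖fderiv ℝ h x - fderiv ℝ h y‖ := by
  simp only [gradient, ← map_sub, LinearIsometryEquiv.norm_map]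

theorem continuous_gradient {h : E → ℝ} (hh : ContDiff ℝ 2 h) : Continuous (∇ h) := by
  have : Continuous (fderiv ℝ h) := hh.continuous_fderiv (by norm_num)
  exact (LinearIsometryEquiv.continuous _).comp this

theorem exists_lipschitz_gradient {h : E → ℝ} (hh : ContDiff ℝ 2 h) (a : E) :
    ∃ L : ℝ, ∃ U ∈ 𝓝 a, ∀ x ∈ U, ∀ y ∈ U, |h x - h y| ≤ L * ‖x - y‖ ∧
      ‖∇ h x - ∇ h y‖ ≤ L * ‖x - y‖ := by
  have h1 : ContDiff ℝ 1 (fderiv ℝ h) := hh.fderiv_right (by norm_num)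
  obtain ⟨K, U, hU, hK⟩ := h1.contDiffAt (x := a).exists_lipschitzOnWith
  obtain ⟨K', U', hU', hK'⟩ := (hh.of_le (by norm_num : (1 : WithTop ℕ∞) ≤ 2)).contDiffAt
    (x := a).exists_lipschitzOnWith
  refine ⟨max K K', U ∩ U', inter_mem hU hU', fun x hx y hy => ⟨?_, ?_⟩⟩
  · have := hK'.dist_le_mul x hx.2 y hy.2
    rw [Real.dist_eq, dist_eq_norm] at this
    exact this.trans (by gcongr; exact le_max_right _ _)
  · rw [norm_gradient_sub]
    have := hK.dist_le_mul x hx.1 y hy.1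
    rw [dist_eq_norm, dist_eq_norm] at this
    exact this.trans (by gcongr; exact le_max_left _ _)

/-- First-order Taylor estimate on a convex set on which the gradient is Lipschitz. -/
theorem abs_sub_sub_inner_gradient_le {h : E → ℝ} (hh : Differentiable ℝ h) {s : Set E}
    (hs : Convex ℝ s) {L : ℝ} (hL : 0 ≤ L)
    (hg : ∀ x ∈ s, ∀ y ∈ s, ‖∇ h x - ∇ h y‖ ≤ L * ‖x - y‖) {x y : E} (hx : x ∈ s) (hy : y ∈ s) :
    |h y - h x - ⟪∇ h x, y - x⟫| ≤ L * ‖y - x‖ ^ 2 := by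
  have hseg : segment ℝ x y ⊆ s := hs.segment_subset hx hy
  have := (convex_segment (𝕜 := ℝ) x y).norm_image_sub_le_of_norm_fderiv_le' (f := h)
    (φ := fderiv ℝ h x) (C := L * ‖y - x‖) (fun z _ => hh z) (fun z hz => ?_)
    (left_mem_segment ℝ x y) (right_mem_segment ℝ x y)
  · rw [inner_gradient_eq_fderiv, pow_two, ← mul_assoc]
    simpa using this
  · rw [← norm_gradient_sub]
    refine (hg z (hseg hz) x hx).trans ?_
    gcongr
    obtain ⟨t, ht, rfl⟩ := (segment_eq_image' ℝ x y ▸ hz : z ∈ (fun θ : ℝ => x + θ • (y - x)) '' _)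
    simp only [add_sub_cancel_left, norm_smul, Real.norm_eq_abs, abs_of_nonneg ht.1]
    exact mul_le_of_le_one_left (norm_nonneg _) ht.2

/-- The trapezoid rule for a `C²` function, with an error of smaller order than `‖x - a‖ ^ 2`. -/
theorem trapezoid_gradient {h : E → ℝ} (hh : ContDiff ℝ 2 h) (a : E) {η : ℝ} (hη : 0 < η) :
    ∀ᶠ x in 𝓝 a, |h x - h a - 1 / 2 * ⟪∇ h x + ∇ h a, x - a⟫| ≤ η * ‖x - a‖ ^ 2 := by
  have h1 : ContDiff ℝ 1 (fderiv ℝ h) := hh.fderiv_right (by norm_num)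
  have hd : HasFDerivAt (fderiv ℝ h) (fderiv ℝ (fderiv ℝ h) a) a :=
    (h1.differentiable (by norm_num) a).hasFDerivAt
  set A := fderiv ℝ (fderiv ℝ h) a
  have hη2 : 0 < η / 2 := by positivity
  obtain ⟨ρ, hρ, hb⟩ := Metric.eventually_nhds_iff_ball.1 (hd.isLittleO.def hη2)
  refine Metric.eventually_nhds_iff_ball.2 ⟨ρ, hρ, fun x hx => ?_⟩
  set u := x - a
  have hmem : ∀ t ∈ Icc (0 : ℝ) 1, a + t • u ∈ Metric.ball a ρ := fun t ht => by
    rw [mem_ball_iff_norm] at hx ⊢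
    rw [add_sub_cancel_left, norm_smul, Real.norm_eq_abs, abs_of_nonneg ht.1]
    exact (mul_le_of_le_one_left (norm_nonneg _) ht.2).trans_lt hx
  have hR : ∀ t ∈ Icc (0 : ℝ) 1,
      |fderiv ℝ h (a + t • u) u - fderiv ℝ h a u - t * A u u| ≤ η / 2 * ‖u‖ ^ 2 := fun t ht => by
    have h3 := hb _ (hmem t ht)
    rw [add_sub_cancel_left] at h3
    have h4 : ‖t • u‖ ≤ ‖u‖ := by
      rw [norm_smul, Real.norm_eq_abs, abs_of_nonneg ht.1]
      exact mul_le_of_le_one_left (norm_nonneg _) ht.2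
    have h5 := (fderiv ℝ h (a + t • u) - fderiv ℝ h a - A (t • u)).le_opNorm u
    have h6 : (fderiv ℝ h (a + t • u) - fderiv ℝ h a - A (t • u)) u =
      fderiv ℝ h (a + t • u) u - fderiv ℝ h a u - t * A u u := by simp
    rw [h6, Real.norm_eq_abs] at h5
    calc _ ≤ _ := h5
      _ ≤ (η / 2 * ‖u‖) * ‖u‖ := by gcongr; exact h3.trans (by gcongr)
      _ = _ := by ring
  -- Mean value inequality along the segment for the remainder of the second-order expansion.
  have hψ : ∀ t ∈ Icc (0 : ℝ) 1, HasDerivWithinAt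
      (fun t : ℝ => h (a + t • u) - t * fderiv ℝ h a u - t ^ 2 / 2 * A u u)
      (fderiv ℝ h (a + t • u) u - fderiv ℝ h a u - t * A u u) (Icc 0 1) t := fun t _ => by
    have e1 : HasDerivAt (fun t : ℝ => a + t • u) u t := by
      simpa using ((hasDerivAt_id t).smul_const u).const_add a
    have e2 := (hh.differentiable (by norm_num) (a + t • u)).hasFDerivAt.comp_hasDerivAt t e1
    have e3 : HasDerivAt (fun t : ℝ => t * fderiv ℝ h a u) (fderiv ℝ h a u) t := by
      simpa using (hasDerivAt_id t).mul_const (fderiv ℝ h a u)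
    have e4 : HasDerivAt (fun t : ℝ => t ^ 2 / 2 * A u u) (t * A u u) t := by
      convert! (((hasDerivAt_id t).pow 2).div_const 2).mul_const (A u u) using 1
      simp
    exact ((e2.sub e3).sub e4).hasDerivWithinAt
  have hmv := (convex_Icc (0 : ℝ) 1).norm_image_sub_le_of_norm_hasDerivWithin_le hψ hR
    (left_mem_Icc.2 zero_le_one) (right_mem_Icc.2 zero_le_one)
  have hR1 := hR 1 (right_mem_Icc.2 zero_le_one)
  have hx1 : a + (1 : ℝ) • u = x := by simp [u]
  rw [hx1] at hR1
  simp only [hx1, Real.norm_eq_abs, zero_smul, add_zero] at hmv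
  norm_num at hmv
  rw [inner_add_left, inner_gradient_eq_fderiv, inner_gradient_eq_fderiv]
  rw [abs_le] at *
  constructor <;> nlinarith [hmv.1, hmv.2, hR1.1, hR1.2]

/-- Metric regularity of a submersion: the distance to the zero set is at most a multiple of the
norm of the value. -/
theorem exists_zero_near_of_surjective {F : Type*} [NormedAddCommGroup F] [NormedSpace ℝ F]
    [CompleteSpace F] {G : E → F} {G' : E →L[ℝ] F} {a : E} (hG : HasStrictFDerivAt G G' a)
    (hs : G'.range = ⊤) (h0 : G a = 0) :
    ∃ C : ℝ, 0 < C ∧ ∀ᶠ x in 𝓝 a, ∃ p, G p = 0 ∧ ‖x - p‖ ≤ C * ‖G x‖ := by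
  set R := G'.nonlinearRightInverseOfSurjective hs
  have hN : 0 < R.nnnorm := G'.nonlinearRightInverseOfSurjective_nnnorm_pos hs
  have hc : 0 < R.nnnorm⁻¹ / 2 := by positivity
  obtain ⟨s, hsa, happ⟩ := hG.approximates_deriv_on_nhds (Or.inr hc)
  obtain ⟨r, hr, hrs⟩ := Metric.mem_nhds_iff.1 hsa
  have hN' : (0 : ℝ) < R.nnnorm := by exact_mod_cast hN
  refine ⟨2 * R.nnnorm, by positivity, ?_⟩
  have hcont : Tendsto (fun x => 2 * (R.nnnorm : ℝ) * ‖G x‖) (𝓝 a) (𝓝 0) := by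
    have := (hG.continuousAt.norm.const_mul (2 * (R.nnnorm : ℝ)))
    simpa [ContinuousAt, h0] using this
  filter_upwards [hcont.eventually_lt_const (half_pos hr), Metric.ball_mem_nhds a (half_pos hr)]
    with x hx hxa
  have hsub : Metric.closedBall x (2 * R.nnnorm * ‖G x‖) ⊆ s := fun y hy => hrs <| by
    rw [Metric.mem_ball] at *
    rw [Metric.mem_closedBall] at hy
    linarith [dist_triangle y x a]
  obtain ⟨p, hp, hp0⟩ := happ.surjOn_closedBall_of_nonlinearRightInverse R (by positivity) hsub
    (show (0 : F) ∈ _ by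
      rw [mem_closedBall_iff_norm, zero_sub, norm_neg]
      apply le_of_eq
      push_cast
      field_simp
      ring)
  exact ⟨p, hp0, by rwa [Metric.mem_closedBall, dist_comm, dist_eq_norm] at hp⟩

end Calculus

/-! ### Convex combinations of affinely independent vectors -/

section AffineAlgebra

variable {E : Type*} [NormedAddCommGroup E] [InnerProductSpace ℝ E] {ι : Type*} [Fintype ι]

/-- The points within distance `r` of a convex combination of those `g i` with `i ∈ A`. -/
def approxHull (g : ι → E) (A : Set ι) (r : ℝ) : Set E :=
  {v | ∃ c : ι → ℝ, (∀ i, 0 ≤ c i) ∧ ∑ i, c i = 1 ∧ (∀ i, c i ≠ 0 → i ∈ A) ∧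
    ‖v - ∑ i, c i • g i‖ ≤ r}

theorem convex_approxHull (g : ι → E) (A : Set ι) (r : ℝ) : Convex ℝ (approxHull g A r) := by
  rintro v ⟨c, hc0, hc1, hcA, hcv⟩ w ⟨d, hd0, hd1, hdA, hdw⟩ a b ha hb hab
  refine ⟨fun i => a * c i + b * d i, fun i => ?_, ?_, fun i hi => ?_, ?_⟩
  · have := hc0 i
    have := hd0 i
    positivity
  · rw [Finset.sum_add_distrib, ← Finset.mul_sum, ← Finset.mul_sum, hc1, hd1]
    simpa using hab
  · by_contra hiA
    have h1 : c i = 0 := by_contra fun h => hiA (hcA i h)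
    have h2 : d i = 0 := by_contra fun h => hiA (hdA i h)
    exact hi (by simp [h1, h2])
  · have e : a • v + b • w - ∑ i, (a * c i + b * d i) • g i =
        a • (v - ∑ i, c i • g i) + b • (w - ∑ i, d i • g i) := by
      simp only [add_smul, mul_smul, Finset.sum_add_distrib, ← Finset.smul_sum, smul_sub]
      abel
    rw [e]
    calc _ ≤ ‖a • (v - ∑ i, c i • g i)‖ + ‖b • (w - ∑ i, d i • g i)‖ := norm_add_le _ _
      _ = a * ‖v - ∑ i, c i • g i‖ + b * ‖w - ∑ i, d i • g i‖ := by
        rw [norm_smul, norm_smul, Real.norm_of_nonneg ha, Real.norm_of_nonneg hb]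
      _ ≤ a * r + b * r := by gcongr
      _ = r := by rw [← add_mul, hab, one_mul]

theorem mem_approxHull_of_norm_sub_le {g : ι → E} {A : Set ι} {r : ℝ} {v : E} {i : ι}
    (hi : i ∈ A) (hv : ‖v - g i‖ ≤ r) : v ∈ approxHull g A r := by
  classical
  refine ⟨Pi.single i 1, fun j => ?_, by simp, fun j hj => ?_, ?_⟩
  · by_cases h : j = i
    · subst h; simp
    · simp [h]
  · by_cases h : j = i
    · rwa [h]
    · simp [h] at hj
  · simpa [Pi.single_apply, ite_smul] using hv

theorem exists_weights_of_mem_convexHull {g : ι → E} {A : Set ι} {v : E}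
    (hv : v ∈ convexHull ℝ (g '' A)) :
    ∃ c : ι → ℝ, (∀ i, 0 ≤ c i) ∧ ∑ i, c i = 1 ∧ (∀ i, c i ≠ 0 → i ∈ A) ∧
      ∑ i, c i • g i = v := by
  have : convexHull ℝ (g '' A) ⊆ approxHull g A 0 := by
    refine convexHull_min ?_ (convex_approxHull g A 0)
    rintro _ ⟨i, hi, rfl⟩
    exact mem_approxHull_of_norm_sub_le hi (by simp)
  obtain ⟨c, h0, h1, hA, h⟩ := this hv
  exact ⟨c, h0, h1, hA, (sub_eq_zero.1 (norm_le_zero_iff.1 h)).symm⟩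

theorem sum_smul_mem_convexHull_image {g : ι → E} {A : Set ι} {c : ι → ℝ} (h0 : ∀ i, 0 ≤ c i)
    (h1 : ∑ i, c i = 1) (hA : ∀ i, c i ≠ 0 → i ∈ A) :
    ∑ i, c i • g i ∈ convexHull ℝ (g '' A) := by
  classical
  have e : ∑ i, c i • g i = ∑ i with c i ≠ 0, c i • g i := by
    rw [Finset.sum_filter]
    exact Finset.sum_congr rfl fun i _ => by by_cases h : c i = 0 <;> simp [h]
  rw [e]
  refine (convex_convexHull ℝ _).sum_mem (fun i _ => h0 i) ?_ fun i hi =>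
    subset_convexHull ℝ _ ⟨i, hA i (Finset.mem_filter.1 hi).2, rfl⟩
  rw [Finset.sum_filter_ne_zero, h1]

theorem norm_sum_smul_sub_le {g g' : ι → E} {c : ι → ℝ} {r : ℝ} (h0 : ∀ i, 0 ≤ c i)
    (h1 : ∑ i, c i = 1) (hg : ∀ i, ‖g i - g' i‖ ≤ r) :
    ‖∑ i, c i • g i - ∑ i, c i • g' i‖ ≤ r := by
  rw [← Finset.sum_sub_distrib]
  calc _ ≤ ∑ i, ‖c i • g i - c i • g' i‖ := norm_sum_le _ _
    _ ≤ ∑ i, c i * r := Finset.sum_le_sum fun i _ => by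
      rw [← smul_sub, norm_smul, Real.norm_of_nonneg (h0 i)]
      exact mul_le_mul_of_nonneg_left (hg i) (h0 i)
    _ = r := by rw [← Finset.sum_mul, h1, one_mul]

namespace AffineIndependent

variable {g : ι → E}

theorem surjective_inner_sub (hg : AffineIndependent ℝ g) (i₀ : ι) :
    Function.Surjective fun (y : E) (i : {i // i ≠ i₀}) => ⟪g i - g i₀, y⟫ := by
  classical
  have hli := (affineIndependent_iff_linearIndependent_vsub ℝ g i₀).1 hg
  simp only [vsub_eq_sub] at hli
  set v : {i // i ≠ i₀} → E := fun i => g i - g i₀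
  let T : E →ₗ[ℝ] ({i // i ≠ i₀} → ℝ) := LinearMap.pi fun i => (innerₛₗ ℝ (v i))
  -- The Gram operator is injective, hence surjective.
  let S : ({i // i ≠ i₀} → ℝ) →ₗ[ℝ] ({i // i ≠ i₀} → ℝ) :=
    T.comp (Fintype.linearCombination ℝ v)
  have hS : Function.Injective S := by
    rw [injective_iff_map_eq_zero]
    intro c hc
    have h1 : ∀ i, ⟪v i, ∑ j, c j • v j⟫ = 0 := fun i => by
      simpa [S, T, Fintype.linearCombination_apply, inner_sum, real_inner_smul_right]
        using congrFun hc i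
    have h2 : ⟪∑ j, c j • v j, ∑ j, c j • v j⟫ = 0 := by
      rw [sum_inner]
      exact Finset.sum_eq_zero fun i _ => by rw [real_inner_smul_left, h1, mul_zero]
    exact funext (Fintype.linearIndependent_iff.1 hli c (inner_self_eq_zero.1 h2))
  intro z
  obtain ⟨c, hc⟩ := LinearMap.injective_iff_surjective.1 hS z
  exact ⟨Fintype.linearCombination ℝ v c, hc⟩

theorem exists_inner_sub_pos (hg : AffineIndependent ℝ g) (i : ι) :
    ∃ y : E, ∀ j, j ≠ i → 0 < ⟪g i - g j, y⟫ := by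
  obtain ⟨y, hy⟩ := hg.surjective_inner_sub i fun _ => -1
  refine ⟨y, fun j hj => ?_⟩
  have h1 := congrFun hy ⟨j, hj⟩
  simp only [inner_sub_left] at h1 ⊢
  linarith

/-- Weights of affinely independent points are controlled by the combination they produce. -/
theorem exists_abs_le_norm_sum_smul (hg : AffineIndependent ℝ g) :
    ∃ C : ℝ, 0 < C ∧ ∀ c : ι → ℝ, ∑ i, c i = 0 → ∀ i, |c i| ≤ C * ‖∑ i, c i • g i‖ := by
  let T : (ι → ℝ) →ₗ[ℝ] ℝ × E :=
    LinearMap.prod (∑ i, LinearMap.proj i) (Fintype.linearCombination ℝ g)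
  have hT : ∀ c, T c = (∑ i, c i, ∑ i, c i • g i) := fun c => by
    simp [T, Fintype.linearCombination_apply]
  have hker : LinearMap.ker T = ⊥ := by
    rw [LinearMap.ker_eq_bot']
    intro c hc
    rw [hT, Prod.mk_eq_zero] at hc
    exact funext fun i => affineIndependent_iff.1 hg Finset.univ c hc.1 hc.2 i (Finset.mem_univ i)
  obtain ⟨K, hK, hanti⟩ := T.exists_antilipschitzWith hker
  refine ⟨K, by exact_mod_cast hK, fun c hc i => ?_⟩
  have := hanti.le_mul_dist c 0
  rw [map_zero, dist_zero_right, dist_zero_right, hT, hc] at this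
  calc |c i| = ‖c i‖ := rfl
    _ ≤ ‖c‖ := norm_le_pi_norm c i
    _ ≤ K * ‖((0 : ℝ), ∑ i, c i • g i)‖ := this
    _ = _ := by simp [Prod.norm_def]

/-- A point of the relative interior of a simplex has positive barycentric coordinates. -/
theorem exists_pos_weights (hg : AffineIndependent ℝ g)
    (h : (0 : E) ∈ intrinsicInterior ℝ (convexHull ℝ (range g))) :
    ∃ c : ι → ℝ, (∀ i, 0 < c i) ∧ ∑ i, c i = 1 ∧ ∑ i, c i • g i = 0 := by
  classical
  obtain ⟨c, hc0, hc1, -, hcv⟩ := exists_weights_of_mem_convexHull (A := univ) (g := g)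
    (by simpa using intrinsicInterior_subset h)
  refine ⟨c, fun i => ?_, hc1, hcv⟩
  obtain ⟨y, hy, hy0⟩ := mem_intrinsicInterior.1 h
  have hgi : g i ∈ affineSpan ℝ (convexHull ℝ (range g)) :=
    subset_affineSpan ℝ _ (subset_convexHull ℝ _ ⟨i, rfl⟩)
  -- A small step from `0` away from `g i` stays in the simplex.
  have hline : ∀ t : ℝ, AffineMap.lineMap (0 : E) (g i) t ∈
      affineSpan ℝ (convexHull ℝ (range g)) := fun t =>
    AffineMap.lineMap_mem t (hy0 ▸ y.2) hgi
  let γ : ℝ → affineSpan ℝ (convexHull ℝ (range g)) := fun t => ⟨_, hline t⟩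
  have hγ : Continuous γ := Continuous.subtype_mk AffineMap.lineMap_continuous _
  have hγ0 : γ 0 = y := Subtype.ext (by simp [γ, hy0])
  have hev : ∀ᶠ t in 𝓝 (0 : ℝ), γ t ∈ Subtype.val ⁻¹' (convexHull ℝ (range g)) :=
    hγ.continuousAt.eventually_mem (by rw [hγ0]; exact mem_interior_iff_mem_nhds.1 hy)
  obtain ⟨ρ, hρ, hb⟩ := Metric.eventually_nhds_iff_ball.1 hev
  have ht := hb (-(ρ / 2)) (by simp [abs_of_pos hρ]; linarith)
  set t := ρ / 2
  have htpos : 0 < t := half_pos hρ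
  have ht' : -(t • g i) ∈ convexHull ℝ (g '' univ) := by
    simpa [γ, AffineMap.lineMap_apply] using ht
  obtain ⟨d, hd0, hd1, -, hdv⟩ := exists_weights_of_mem_convexHull ht'
  have hkey := affineIndependent_iff.1 hg Finset.univ
    (fun j => d j + (Pi.single i t : ι → ℝ) j - (1 + t) * c j)
    (by rw [Finset.sum_sub_distrib, Finset.sum_add_distrib, ← Finset.mul_sum, hd1, hc1]; simp)
    (by
      simp only [sub_smul, add_smul, mul_smul, Finset.sum_sub_distrib, Finset.sum_add_distrib,
        ← Finset.smul_sum, hdv, hcv]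
      simp [Pi.single_apply, ite_smul])
    i (Finset.mem_univ i)
  simp only [Pi.single_eq_same] at hkey
  have := hd0 i
  by_contra hneg
  have : (1 + t) * c i ≤ 0 := mul_nonpos_of_nonneg_of_nonpos (by linarith) (not_lt.1 hneg)
  linarith

end AffineIndependent

end AffineAlgebra

/-! ### The Clarke subdifferential of a maximum of smooth functions -/

section MaxFunctions

variable {E ι : Type*} {f : E → ℝ} {fi : ι → E → ℝ} {x : E}

/-- The indices at which the maximum of the values `fi i x` is attained. -/
def activeIndices (fi : ι → E → ℝ) (x : E) : Set ι := {i | ∀ j, fi j x ≤ fi i x}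

theorem eq_of_mem_activeIndices {i : ι} (hx : IsGreatest (range fun i => fi i x) (f x))
    (hi : i ∈ activeIndices fi x) : f x = fi i x := by
  obtain ⟨⟨j, hj⟩, hub⟩ := hx
  exact le_antisymm (hj ▸ hi j) (hub ⟨i, rfl⟩)

theorem exists_mem_activeIndices (hx : IsGreatest (range fun i => fi i x) (f x)) :
    ∃ i, i ∈ activeIndices fi x ∧ f x = fi i x := by
  obtain ⟨⟨i, hi⟩, hub⟩ := hx
  simp only at hi
  exact ⟨i, fun j => hi ▸ hub ⟨j, rfl⟩, hi.symm⟩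

theorem activeIndices_eq_univ (hx : x ∈ activeManifold fi) : activeIndices fi x = univ :=
  eq_univ_of_forall fun i j => (hx j i).le

variable [NormedAddCommGroup E] [InnerProductSpace ℝ E]

theorem tendsto_add_smul_nhdsGT (x y : E) :
    Tendsto (fun t : ℝ => x + t • y) (𝓝[>] 0) (𝓝 x) := by
  have : Continuous fun t : ℝ => x + t • y := by fun_prop
  simpa using (this.tendsto 0).mono_left nhdsWithin_le_nhds

variable [CompleteSpace E]

theorem hasDerivAt_comp_add_smul {h : E → ℝ} (hh : DifferentiableAt ℝ h x) (y : E) :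
    HasDerivAt (fun t : ℝ => h (x + t • y)) ⟪∇ h x, y⟫ 0 := by
  have hline : HasDerivAt (fun t : ℝ => x + t • y) y 0 := by
    simpa using ((hasDerivAt_id (0 : ℝ)).smul_const y).const_add x
  have h1 : HasFDerivAt h (fderiv ℝ h x) (x + (0 : ℝ) • y) := by simpa using hh.hasFDerivAt
  rw [inner_gradient_eq_fderiv]
  exact h1.comp_hasDerivAt 0 hline

/-- Where a pointwise maximum is differentiable, it has the gradient of each active function. -/
theorem gradient_eq_of_mem_activeIndices {i : ι}
    (hf : ∀ᶠ y in 𝓝 x, IsGreatest (range fun i => fi i y) (f y))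
    (hi : i ∈ activeIndices fi x) (hfi : DifferentiableAt ℝ (fi i) x)
    (hd : DifferentiableAt ℝ f x) : ∇ f x = ∇ (fi i) x := by
  have hmin : IsLocalMin (fun y => f y - fi i y) x := by
    filter_upwards [hf] with y hy
    rw [eq_of_mem_activeIndices hf.self_of_nhds hi, sub_self]
    exact sub_nonneg.2 (hy.2 ⟨i, rfl⟩)
  have h0 := hmin.fderiv_eq_zero
  rw [fderiv_fun_sub hd hfi, sub_eq_zero] at h0
  rw [gradient, gradient, h0]

theorem clarkeSubdiff_subset_convexHull [Finite ι] (hs : ∀ i, ContDiff ℝ 2 (fi i))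
    (hf : ∀ᶠ y in 𝓝 x, IsGreatest (range fun i => fi i y) (f y)) :
    clarkeSubdiff f x ⊆ convexHull ℝ ((fun i => ∇ (fi i) x) '' activeIndices fi x) := by
  refine closure_minimal (convexHull_mono ?_) ((toFinite _).isClosed_convexHull ℝ)
  rintro v ⟨xs, hxs, hd, hv⟩
  have hev : ∀ᶠ r in atTop, ∃ i, i ∈ activeIndices fi (xs r) ∧ ∇ f (xs r) = ∇ (fi i) (xs r) := by
    filter_upwards [hxs.eventually hf.eventually_nhds] with r hr
    obtain ⟨i, hi, -⟩ := exists_mem_activeIndices hr.self_of_nhds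
    exact ⟨i, hi, gradient_eq_of_mem_activeIndices hr hi
      ((hs i).differentiable (by norm_num) _) (hd r)⟩
  -- Some index is active at infinitely many terms of the sequence.
  obtain ⟨i, hi⟩ : ∃ i, ∃ᶠ r in atTop, i ∈ activeIndices fi (xs r) ∧
      ∇ f (xs r) = ∇ (fi i) (xs r) := by
    by_contra! hcon
    obtain ⟨r, ⟨i, hi⟩, hr⟩ := (hev.and (eventually_all.2 fun i => hcon i)).exists
    exact hr i hi.1 hi.2
  refine ⟨i, fun j => ?_, ?_⟩
  · have hcont : ∀ k, Tendsto (fun r => fi k (xs r)) atTop (𝓝 (fi k x)) := fun k =>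
      ((hs k).continuous.tendsto x).comp hxs
    have hlim := (hcont i).sub (hcont j)
    exact sub_nonneg.1 (ge_of_tendsto_of_frequently hlim
      (hi.mono fun r hr => sub_nonneg.2 (hr.1 j)))
  · exact tendsto_nhds_unique_of_frequently_eq
      (((continuous_gradient (hs i)).tendsto x).comp hxs) hv (hi.mono fun r hr => hr.2.symm)

theorem convexHull_subset_clarkeSubdiff [Finite ι] (hs : ∀ i, ContDiff ℝ 2 (fi i))
    (hf : ∀ᶠ y in 𝓝 x, IsGreatest (range fun i => fi i y) (f y))
    (haff : AffineIndependent ℝ fun i => ∇ (fi i) x) :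
    convexHull ℝ ((fun i => ∇ (fi i) x) '' activeIndices fi x) ⊆ clarkeSubdiff f x := by
  cases nonempty_fintype ι
  refine (convexHull_mono ?_).trans subset_closure
  rintro _ ⟨i, hi, rfl⟩
  obtain ⟨y, hy⟩ := haff.exists_inner_sub_pos i
  -- Moving from `x` in the direction `y` leaves `i` as the only active index.
  have hpt := tendsto_add_smul_nhdsGT x y
  have hlt : ∀ᶠ t : ℝ in 𝓝[>] 0, ∀ j, j ≠ i → fi j (x + t • y) < fi i (x + t • y) := by
    refine eventually_all.2 fun j => ?_
    by_cases hj : j = i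
    · simp [hj]
    have hder : ∀ k, HasDerivAt (fun t : ℝ => fi k (x + t • y)) (⟪∇ (fi k) x, y⟫) 0 := fun k =>
      hasDerivAt_comp_add_smul ((hs k).differentiable (by norm_num) x) y
    have hslope := ((hder i).sub (hder j)).tendsto_slope_zero_right
    rw [← inner_sub_left] at hslope
    filter_upwards [hslope.eventually_const_lt (hy j hj), self_mem_nhdsWithin] with t ht ht0 _
    have h1 := hi j
    simp only [Pi.sub_apply, zero_add, zero_smul, add_zero, smul_eq_mul] at ht
    have h2 := pos_of_mul_pos_right ht (inv_nonneg.2 (le_of_lt ht0))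
    linarith
  have hgood : ∀ᶠ t : ℝ in 𝓝[>] 0, DifferentiableAt ℝ f (x + t • y) ∧
      ∇ f (x + t • y) = ∇ (fi i) (x + t • y) := by
    filter_upwards [hlt, hpt.eventually hf.eventually_nhds] with t ht hft
    have hnear : ∀ᶠ z in 𝓝 (x + t • y), ∀ j, j ≠ i → fi j z < fi i z :=
      eventually_all.2 fun j => by
        by_cases hj : j = i
        · simp [hj]
        · filter_upwards [(hs j).continuous.continuousAt.eventually_lt
            (hs i).continuous.continuousAt (ht j hj)] with z hz _ using hz
    have heq : f =ᶠ[𝓝 (x + t • y)] fi i := by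
      filter_upwards [hnear, hft] with z hz hfz
      refine eq_of_mem_activeIndices hfz fun j => ?_
      by_cases hj : j = i
      · rw [hj]
      · exact (hz j hj).le
    refine ⟨((hs i).differentiable (by norm_num) _).congr_of_eventuallyEq heq, ?_⟩
    rw [gradient, gradient, heq.fderiv_eq]
  obtain ⟨ts, hts, hp⟩ := exists_seq_forall_of_frequently hgood.frequently
  refine ⟨fun n => x + ts n • y, hpt.comp hts, fun n => (hp n).1, ?_⟩
  simp only [fun n => (hp n).2]
  exact ((continuous_gradient (hs i)).tendsto x).comp (hpt.comp hts)

theorem clarkeSubdiff_eq_convexHull [Finite ι] (hs : ∀ i, ContDiff ℝ 2 (fi i))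
    (hf : ∀ᶠ y in 𝓝 x, IsGreatest (range fun i => fi i y) (f y))
    (haff : AffineIndependent ℝ fun i => ∇ (fi i) x) :
    clarkeSubdiff f x = convexHull ℝ ((fun i => ∇ (fi i) x) '' activeIndices fi x) :=
  (clarkeSubdiff_subset_convexHull hs hf).antisymm (convexHull_subset_clarkeSubdiff hs hf haff)

/-- At a point of the active manifold, a maximum of smooth functions with affinely independent
gradients is subdifferentially regular. -/
theorem subdiffRegularAt_of_mem_activeManifold [Finite ι] (hs : ∀ i, ContDiff ℝ 2 (fi i))
    (hf : ∀ᶠ y in 𝓝 x, IsGreatest (range fun i => fi i y) (f y))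
    (haff : AffineIndependent ℝ fun i => ∇ (fi i) x) (hx : x ∈ activeManifold fi) :
    SubdiffRegularAt f x := by
  intro y
  cases nonempty_fintype ι
  obtain ⟨i₀, -, -⟩ := exists_mem_activeIndices hf.self_of_nhds
  have hne : (Finset.univ : Finset ι).Nonempty := ⟨i₀, Finset.mem_univ _⟩
  have hact := activeIndices_eq_univ hx
  refine ⟨Finset.univ.sup' hne fun i => ⟪∇ (fi i) x, y⟫, ⟨?_, ?_⟩, ?_⟩
  · obtain ⟨i, -, hi⟩ := Finset.exists_mem_eq_sup' hne fun i => ⟪∇ (fi i) x, y⟫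
    rw [clarkeSubdiff_eq_convexHull hs hf haff, hi, hact]
    exact ⟨_, subset_convexHull ℝ _ ⟨i, mem_univ i, rfl⟩, rfl⟩
  · rintro _ ⟨v, hv, rfl⟩
    obtain ⟨c, hc0, hc1, -, rfl⟩ :=
      exists_weights_of_mem_convexHull (clarkeSubdiff_subset_convexHull hs hf hv)
    simp only [sum_inner, real_inner_smul_left]
    calc ∑ i, c i * ⟪∇ (fi i) x, y⟫
        ≤ ∑ i, c i * Finset.univ.sup' hne fun i => ⟪∇ (fi i) x, y⟫ :=
          Finset.sum_le_sum fun i _ => mul_le_mul_of_nonneg_left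
            (Finset.le_sup' (fun i => ⟪∇ (fi i) x, y⟫) (Finset.mem_univ i)) (hc0 i)
      _ = _ := by rw [← Finset.sum_mul, hc1, one_mul]
  · have hder : ∀ k, HasDerivAt (fun t : ℝ => fi k (x + t • y)) (⟪∇ (fi k) x, y⟫) 0 := fun k =>
      hasDerivAt_comp_add_smul ((hs k).differentiable (by norm_num) x) y
    have hlim := Tendsto.finset_sup'_nhds_apply hne fun i _ =>
      (hder i).tendsto_slope_zero_right
    refine hlim.congr' ?_
    have hpt := tendsto_add_smul_nhdsGT x y
    filter_upwards [hpt.eventually hf, self_mem_nhdsWithin] with t ht ht0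
    have hf0 : ∀ i, f x = fi i x := fun i =>
      eq_of_mem_activeIndices hf.self_of_nhds (hact ▸ mem_univ i)
    obtain ⟨i, -, hi⟩ := exists_mem_activeIndices ht
    have ht1 : 0 ≤ t⁻¹ := inv_nonneg.2 (le_of_lt ht0)
    simp only [zero_add, zero_smul, add_zero, smul_eq_mul, one_div, ← hf0]
    refine le_antisymm (Finset.sup'_le _ _ fun j _ => ?_) ?_
    · exact mul_le_mul_of_nonneg_left (sub_le_sub_right (ht.2 ⟨j, rfl⟩) _) ht1
    · rw [hi]
      exact Finset.le_sup' (fun i => t⁻¹ * (fi i (x + t • y) - f x)) (Finset.mem_univ i)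

end MaxFunctions

/-! ### The active manifold and uniform local estimates -/

section ActiveManifold

variable {E ι : Type*} {fi : ι → E → ℝ} {x : E}

/-- The defining map of the active manifold: the differences of the values `fi i x` to the
reference value `fi i₀ x`. -/
def valueDiff (fi : ι → E → ℝ) (i₀ : ι) (x : E) (i : {i // i ≠ i₀}) : ℝ := fi i x - fi i₀ x

theorem valueDiff_eq_zero_iff (i₀ : ι) : valueDiff fi i₀ x = 0 ↔ x ∈ activeManifold fi := by
  refine ⟨fun h => ?_, fun h => funext fun i => sub_eq_zero.2 (h i i₀)⟩
  have key : ∀ i, fi i x = fi i₀ x := fun i => by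
    by_cases hi : i = i₀
    · rw [hi]
    · exact sub_eq_zero.1 (congrFun h ⟨i, hi⟩)
  exact fun i j => (key i).trans (key j).symm

variable [NormedAddCommGroup E]

theorem isClosed_activeManifold (hc : ∀ i, Continuous (fi i)) : IsClosed (activeManifold fi) := by
  simp only [activeManifold, ofPred_forall]
  exact isClosed_iInter fun i => isClosed_iInter fun j => isClosed_eq (hc i) (hc j)

variable [InnerProductSpace ℝ E] [Fintype ι]

theorem contDiff_valueDiff [DecidableEq ι] (hs : ∀ i, ContDiff ℝ 2 (fi i)) (i₀ : ι) :
    ContDiff ℝ 2 (valueDiff fi i₀) :=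
  contDiff_pi.2 fun i => (hs i).sub (hs i₀)

variable [CompleteSpace E]

theorem surjective_fderiv_valueDiff [DecidableEq ι] (hs : ∀ i, ContDiff ℝ 2 (fi i)) (i₀ : ι)
    (haff : AffineIndependent ℝ fun i => ∇ (fi i) x) :
    Function.Surjective (fderiv ℝ (valueDiff fi i₀) x) := by
  have hd : HasFDerivAt (valueDiff fi i₀) (ContinuousLinearMap.pi fun i : {i // i ≠ i₀} =>
      fderiv ℝ (fi i) x - fderiv ℝ (fi i₀) x) x :=
    hasFDerivAt_pi.2 fun i => ((hs i).differentiable (by norm_num) x).hasFDerivAt.sub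
      ((hs i₀).differentiable (by norm_num) x).hasFDerivAt
  intro z
  obtain ⟨y, hy⟩ := haff.surjective_inner_sub i₀ z
  refine ⟨y, ?_⟩
  rw [hd.fderiv, ← hy]
  ext i
  simp [inner_sub_left]

theorem eventually_affineIndependent_gradient (hs : ∀ i, ContDiff ℝ 2 (fi i))
    (haff : AffineIndependent ℝ fun i => ∇ (fi i) x) :
    ∀ᶠ y in 𝓝 x, AffineIndependent ℝ fun i => ∇ (fi i) y := by
  have hc : Continuous fun y i => ∇ (fi i) y :=
    continuous_pi fun i => continuous_gradient (hs i)
  exact hc.continuousAt.eventually (isOpen_setOfPred_affineIndependent.mem_nhds haff)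

theorem isC2ManifoldAround_activeManifold [Nonempty ι] (hs : ∀ i, ContDiff ℝ 2 (fi i))
    (haff : AffineIndependent ℝ fun i => ∇ (fi i) x) (hx : x ∈ activeManifold fi) :
    IsC2ManifoldAround (activeManifold fi) x := by
  classical
  obtain ⟨i₀⟩ := ‹Nonempty ι›
  obtain ⟨U, hU, hUo, hxU⟩ :=
    eventually_nhds_iff.1 (eventually_affineIndependent_gradient hs haff)
  let e : ({i // i ≠ i₀} → ℝ) ≃L[ℝ] EuclideanSpace ℝ (Fin (Fintype.card {i // i ≠ i₀})) :=
    ContinuousLinearEquiv.ofFinrankEq (by simp)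
  refine ⟨hx, U, hUo, hxU, _, e ∘ valueDiff fi i₀,
    (e.contDiff.comp (contDiff_valueDiff hs i₀)).contDiffOn, fun y hy => ?_, ?_⟩
  · rw [e.comp_fderiv]
    exact e.surjective.comp (surjective_fderiv_valueDiff hs i₀ (hU y hy))
  · ext y
    simp [← valueDiff_eq_zero_iff i₀, and_comm]

/-- Metric regularity of the equations of the active manifold: the distance to it is controlled by
the spread of the values `fi i x`. -/
theorem exists_mem_activeManifold_near [FiniteDimensional ℝ E] [Nonempty ι]
    (hs : ∀ i, ContDiff ℝ 2 (fi i)) (haff : AffineIndependent ℝ fun i => ∇ (fi i) x)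
    (hx : x ∈ activeManifold fi) :
    ∃ C : ℝ, 0 < C ∧ ∀ᶠ y in 𝓝 x, ∀ Δ : ℝ, (∀ i j, |fi i y - fi j y| ≤ Δ) →
      ∃ p ∈ activeManifold fi, ‖y - p‖ ≤ C * Δ := by
  classical
  obtain ⟨i₀⟩ := ‹Nonempty ι›
  have hstrict := (contDiff_valueDiff hs i₀).contDiffAt.hasStrictFDerivAt (x := x) (by norm_num)
  obtain ⟨C, hC, hev⟩ := exists_zero_near_of_surjective hstrict
    (LinearMap.range_eq_top.2 (surjective_fderiv_valueDiff hs i₀ haff))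
    ((valueDiff_eq_zero_iff i₀).2 hx)
  refine ⟨C, hC, hev.mono ?_⟩
  rintro y ⟨p, hp, hyp⟩ Δ hΔ
  refine ⟨p, (valueDiff_eq_zero_iff i₀).1 hp, hyp.trans ?_⟩
  gcongr
  exact (pi_norm_le_iff_of_nonneg ((abs_nonneg _).trans (hΔ i₀ i₀))).2 fun i => hΔ i i₀

/-- Uniform first-order estimates for `f = max fi` on the ball of radius `ρ` around `xbar`, with a
single constant `C`. -/
structure LocalEstimates (f : E → ℝ) (fi : ι → E → ℝ) (xbar : E) (ρ C : ℝ) : Prop where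
  radius_pos : 0 < ρ
  const_pos : 0 < C
  isGreatest : ∀ x ∈ Metric.ball xbar ρ, IsGreatest (range fun i => fi i x) (f x)
  affineIndependent : ∀ x ∈ Metric.ball xbar ρ, AffineIndependent ℝ fun i => ∇ (fi i) x
  lipschitz : ∀ x ∈ Metric.ball xbar ρ, ∀ y ∈ Metric.ball xbar ρ, ∀ i,
    |fi i x - fi i y| ≤ C * ‖x - y‖
  lipschitz_gradient : ∀ x ∈ Metric.ball xbar ρ, ∀ y ∈ Metric.ball xbar ρ, ∀ i,
    ‖∇ (fi i) x - ∇ (fi i) y‖ ≤ C * ‖x - y‖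
  taylor : ∀ x ∈ Metric.ball xbar ρ, ∀ y ∈ Metric.ball xbar ρ, ∀ i,
    |fi i y - fi i x - ⟪∇ (fi i) x, y - x⟫| ≤ C * ‖y - x‖ ^ 2
  metric_regular : ∀ x ∈ Metric.ball xbar ρ, ∀ Δ : ℝ, (∀ i j, |fi i x - fi j x| ≤ Δ) →
    ∃ p ∈ activeManifold fi, ‖x - p‖ ≤ C * Δ

theorem exists_localEstimates [FiniteDimensional ℝ E] {f : E → ℝ} {xbar : E}
    (hf : IsStrongC2Max f fi xbar) : ∃ ρ C : ℝ, LocalEstimates f fi xbar ρ C := by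
  have hne : Nonempty ι := (exists_mem_activeIndices hf.eq_max.self_of_nhds).nonempty
  obtain ⟨C₁, hC₁, hreg⟩ :=
    exists_mem_activeManifold_near hf.smooth hf.affineIndependent hf.values_eq
  choose L U hU hL using fun i => exists_lipschitz_gradient (hf.smooth i) xbar
  obtain ⟨C₂, hC₂⟩ := Finite.exists_le L
  set C := max C₁ C₂
  have hC : 0 < C := lt_max_of_lt_left hC₁
  obtain ⟨ρ, hρ, hball⟩ := Metric.eventually_nhds_iff_ball.1 <| hf.eq_max.and <|
    (eventually_affineIndependent_gradient hf.smooth hf.affineIndependent).and <|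
    hreg.and (eventually_all.2 hU)
  have hlip : ∀ x ∈ Metric.ball xbar ρ, ∀ y ∈ Metric.ball xbar ρ, ∀ i,
      |fi i x - fi i y| ≤ C * ‖x - y‖ ∧ ‖∇ (fi i) x - ∇ (fi i) y‖ ≤ C * ‖x - y‖ := by
    intro x hx y hy i
    have hLC : L i * ‖x - y‖ ≤ C * ‖x - y‖ := by
      gcongr
      exact (hC₂ i).trans (le_max_right _ _)
    have h := hL i x ((hball x hx).2.2.2 i) y ((hball y hy).2.2.2 i)
    exact ⟨h.1.trans hLC, h.2.trans hLC⟩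
  refine ⟨ρ, C, hρ, hC, fun x hx => (hball x hx).1, fun x hx => (hball x hx).2.1,
    fun x hx y hy i => (hlip x hx y hy i).1, fun x hx y hy i => (hlip x hx y hy i).2,
    fun x hx y hy i => ?_, fun x hx Δ hΔ => ?_⟩
  · exact abs_sub_sub_inner_gradient_le ((hf.smooth i).differentiable (by norm_num))
      (convex_ball xbar ρ) hC.le (fun x hx y hy => (hlip x hx y hy i).2) hx hy
  · obtain ⟨p, hp, hxp⟩ := (hball x hx).2.2.1 Δ hΔ
    obtain ⟨i⟩ := hne
    have hΔ0 : 0 ≤ Δ := (abs_nonneg _).trans (hΔ i i)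
    exact ⟨p, hp, hxp.trans (by gcongr; exact le_max_left _ _)⟩

end ActiveManifold

/-! ### Robust growth and the Goldstein modulus -/

namespace LocalEstimates

variable {E : Type*} [NormedAddCommGroup E] [InnerProductSpace ℝ E] [CompleteSpace E]
  {ι : Type*} {f : E → ℝ} {fi : ι → E → ℝ} {xbar : E} {ρ C : ℝ}

theorem eventually_isGreatest (h : LocalEstimates f fi xbar ρ C) {x : E}
    (hx : x ∈ Metric.ball xbar ρ) : ∀ᶠ y in 𝓝 x, IsGreatest (range fun i => fi i y) (f y) := by
  filter_upwards [Metric.isOpen_ball.mem_nhds hx] with y hy using h.isGreatest y hy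

theorem center_mem (h : LocalEstimates f fi xbar ρ C) : xbar ∈ Metric.ball xbar ρ :=
  Metric.mem_ball_self h.radius_pos

theorem lipschitzOnWith (h : LocalEstimates f fi xbar ρ C) :
    LipschitzOnWith C.toNNReal f (Metric.ball xbar ρ) := by
  have key : ∀ x ∈ Metric.ball xbar ρ, ∀ y ∈ Metric.ball xbar ρ, f x - f y ≤ C * ‖x - y‖ := by
    intro x hx y hy
    obtain ⟨i, -, hi⟩ := exists_mem_activeIndices (h.isGreatest x hx)
    have h1 := (h.isGreatest y hy).2 ⟨i, rfl⟩
    have h2 := le_of_abs_le (h.lipschitz x hx y hy i)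
    simp only at h1
    linarith
  refine LipschitzOnWith.of_dist_le_mul fun x hx y hy => ?_
  rw [Real.dist_eq, dist_eq_norm, Real.coe_toNNReal _ h.const_pos.le, abs_le]
  have h1 := key y hy x hx
  rw [norm_sub_rev] at h1
  exact ⟨by linarith, key x hx y hy⟩

/-- Near `xbar`, the nearest point of the active manifold is unique: the midpoint `m` of two
nearest points `p`, `q` is closer to `x` by an amount of order `‖p - q‖ ^ 2`, and, the values
`fi i m` agreeing up to order `‖p - q‖ ^ 2`, metric regularity moves it back to the manifold at
too small a cost. -/
theorem eventually_existsUnique_isNearestPoint [FiniteDimensional ℝ E]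
    (h : LocalEstimates f fi xbar ρ C) (hs : ∀ i, ContDiff ℝ 2 (fi i))
    (hxbar : xbar ∈ activeManifold fi) :
    ∀ᶠ x in 𝓝 xbar, ∃! p, IsNearestPoint (activeManifold fi) x p := by
  have hC := h.const_pos
  -- Radius `ρ / 4` keeps the nearest points in the ball; `1 / (4 * C ^ 2)` makes the cost of moving
  -- `m` back to the manifold smaller than the gain in distance.
  have hr : 0 < min (ρ / 4) (1 / (4 * C ^ 2)) :=
    lt_min (by linarith [h.radius_pos]) (by positivity)
  filter_upwards [Metric.ball_mem_nhds xbar hr] with x hx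
  rw [mem_ball_iff_norm, lt_min_iff] at hx
  obtain ⟨p, hp, hxp⟩ := (isClosed_activeManifold fun i => (hs i).continuous).exists_infDist_eq_dist
    ⟨xbar, hxbar⟩ x
  have hpn : IsNearestPoint (activeManifold fi) x p := by
    refine ⟨hp, fun q hq => ?_⟩
    rw [← dist_eq_norm, ← dist_eq_norm, ← hxp]
    exact Metric.infDist_le_dist_of_mem hq
  refine ⟨p, hpn, fun q hqn => ?_⟩
  obtain ⟨hq, hqmin⟩ := hqn
  have hd : ‖x - q‖ = ‖x - p‖ := le_antisymm (hqmin p hp) (hpn.2 q hq)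
  have hdr : ‖x - p‖ ≤ ‖x - xbar‖ := hpn.2 xbar hxbar
  set d := ‖x - p‖
  set e := ‖p - q‖
  set m : E := (1 / 2 : ℝ) • (p + q)
  have hpm : p - m = (1 / 2 : ℝ) • (p - q) := by simp only [m]; module
  have hqm : q - m = -((1 / 2 : ℝ) • (p - q)) := by simp only [m]; module
  have hnpm : ‖p - m‖ = e / 2 := by
    rw [hpm, norm_smul]; norm_num; ring
  have hnqm : ‖q - m‖ = e / 2 := by
    rw [hqm, norm_neg, ← hpm, hnpm]
  have hed : e ≤ 2 * d := by
    have := norm_sub_le_norm_sub_add_norm_sub p x q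
    rw [norm_sub_rev p x] at this
    linarith
  have hpb : p ∈ Metric.ball xbar ρ := by
    rw [mem_ball_iff_norm]
    have := norm_sub_le_norm_sub_add_norm_sub p x xbar
    rw [norm_sub_rev p x] at this
    linarith [h.radius_pos]
  have hqb : q ∈ Metric.ball xbar ρ := by
    rw [mem_ball_iff_norm]
    have := norm_sub_le_norm_sub_add_norm_sub q x xbar
    rw [norm_sub_rev q x] at this
    linarith [h.radius_pos]
  have hmb : m ∈ Metric.ball xbar ρ := by
    have := (convex_ball xbar ρ) hpb hqb (by norm_num : (0 : ℝ) ≤ 1 / 2)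
      (by norm_num : (0 : ℝ) ≤ 1 / 2) (by norm_num)
    rwa [← smul_add] at this
  have hval : ∀ i, |fi i m - (fi i p + fi i q) / 2| ≤ C * e ^ 2 / 4 := fun i => by
    have h1 := h.taylor m hmb p hpb i
    have h2 := h.taylor m hmb q hqb i
    rw [hnpm, hpm] at h1
    rw [hnqm, hqm, inner_neg_right] at h2
    rw [abs_le] at *
    constructor <;> nlinarith [h1.1, h1.2, h2.1, h2.2]
  obtain ⟨m', hm', hmm'⟩ := h.metric_regular m hmb (C * e ^ 2 / 2) fun i j => by
    have h1 := abs_le.1 (hval i)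
    have h2 := abs_le.1 (hval j)
    rw [hp i j, hq i j] at h1
    rw [abs_le]
    constructor <;> linarith [h1.1, h1.2, h2.1, h2.2]
  have hxm : ‖x - m‖ ^ 2 = d ^ 2 - e ^ 2 / 4 := by
    have h1 := parallelogram_law_with_norm ℝ (x - p) (x - q)
    have h2 : x - p + (x - q) = (2 : ℝ) • (x - m) := by simp only [m]; module
    have h3 : x - p - (x - q) = -(p - q) := by abel
    rw [h2, h3, norm_neg, norm_smul, hd] at h1
    norm_num at h1
    nlinarith [h1]
  have hdm : d ≤ ‖x - m‖ + C ^ 2 / 2 * e ^ 2 := by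
    have h1 := hpn.2 m' hm'
    have h2 := norm_sub_le_norm_sub_add_norm_sub x m m'
    have h3 : C * (C * e ^ 2 / 2) = C ^ 2 / 2 * e ^ 2 := by ring
    linarith
  have hKd : C ^ 2 / 2 * d < 1 / 8 := by
    have h1 : d < 1 / (4 * C ^ 2) := hdr.trans_lt hx.2
    rw [lt_div_iff₀ (by positivity)] at h1
    linarith
  have he0 : 0 ≤ e := norm_nonneg _
  have hd0 : 0 ≤ d := norm_nonneg _
  -- `d - K e² ≤ ‖x - m‖`, where `K = C² / 2`, contradicts `‖x - m‖² = d² - e² / 4` unless `e = 0`.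
  have he : e = 0 := by
    by_contra hne
    have hepos : 0 < e := lt_of_le_of_ne he0 (Ne.symm hne)
    set K := C ^ 2 / 2
    have h5 : K * e ^ 2 ≤ d := by
      have : K * e ^ 2 ≤ K * (2 * d) ^ 2 := by gcongr
      nlinarith
    have h6 : (d - K * e ^ 2) ^ 2 ≤ ‖x - m‖ ^ 2 := by
      apply pow_le_pow_left₀ <;> linarith
    rw [hxm] at h6
    have h7 : 0 < e ^ 2 := by positivity
    nlinarith [sq_nonneg (K * e ^ 2)]
  exact (sub_eq_zero.1 (norm_eq_zero.1 he)).symm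

variable [Fintype ι]

theorem subdiffUpperLipschitz (h : LocalEstimates f fi xbar ρ C)
    (hs : ∀ i, ContDiff ℝ 2 (fi i)) : SubdiffUpperLipschitz f (activeManifold fi) xbar := by
  refine ⟨C, h.const_pos, _, Metric.ball_mem_nhds xbar h.radius_pos, fun x hx y hy hxM v hv => ?_⟩
  obtain ⟨c, hc0, hc1, -, rfl⟩ := exists_weights_of_mem_convexHull
    (clarkeSubdiff_subset_convexHull hs (h.eventually_isGreatest hy) hv)
  have hw : ∑ i, c i • ∇ (fi i) x ∈ clarkeSubdiff f x :=
    convexHull_subset_clarkeSubdiff hs (h.eventually_isGreatest hx) (h.affineIndependent x hx)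
      (sum_smul_mem_convexHull_image hc0 hc1 fun i _ => activeIndices_eq_univ hxM ▸ mem_univ i)
  refine Set.mem_add.2 ⟨_, hw, ∑ i, c i • ∇ (fi i) y - ∑ i, c i • ∇ (fi i) x, ?_, by abel⟩
  have hr : 0 ≤ C * ‖x - y‖ := mul_nonneg h.const_pos.le (norm_nonneg _)
  rw [smul_unitClosedBall_of_nonneg hr, mem_closedBall_zero_iff, norm_sub_rev x y]
  exact norm_sum_smul_sub_le hc0 hc1 fun i => h.lipschitz_gradient y hy x hx i

/-- The aiming inequality. A subgradient `v` at `x` satisfies `⟪v, x - p⟫ ≈ f x - f p`. With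
`∑ l i • ∇ (fi i) xbar = 0`, the average of the increments `fi i x - fi i p` is of smaller order
than `‖x - p‖`, whereas by metric regularity their spread is at least a multiple of `‖x - p‖`;
hence the largest increment, which is `f x - f p`, is at least a multiple of `‖x - p‖`. -/
theorem exists_aiming_bound (h : LocalEstimates f fi xbar ρ C) (hs : ∀ i, ContDiff ℝ 2 (fi i))
    (hxbar : xbar ∈ activeManifold fi) {l : ι → ℝ} (hl : ∀ i, 0 < l i) (hl1 : ∑ i, l i = 1)
    (hl0 : ∑ i, l i • ∇ (fi i) xbar = 0) :
    ∃ μ : ℝ, 0 < μ ∧ ∀ᶠ x in 𝓝 xbar, ∀ p, IsNearestPoint (activeManifold fi) x p →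
      ∀ v ∈ clarkeSubdiff f x, μ * ‖x - p‖ ≤ ⟪v, x - p⟫ := by
  have hC := h.const_pos
  have hne : Nonempty ι :=
    (exists_mem_activeIndices (h.isGreatest xbar h.center_mem)).nonempty
  obtain ⟨i₀, hi₀⟩ := Finite.exists_min l
  set ℓ := l i₀
  have hℓ : 0 < ℓ := hl i₀
  -- The error terms below add up to `4 * C * r * d`, at most half of the main term `ℓ / C * d`
  -- when `r ≤ ℓ / (8 * C ^ 2)`.
  have hr : 0 < min (ρ / 2) (ℓ / (8 * C ^ 2)) :=
    lt_min (by linarith [h.radius_pos]) (by positivity)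
  set r := min (ρ / 2) (ℓ / (8 * C ^ 2))
  refine ⟨ℓ / (2 * C), by positivity, ?_⟩
  filter_upwards [Metric.ball_mem_nhds xbar hr] with x hx p hp v hv
  rw [mem_ball_iff_norm] at hx
  have hrρ : r ≤ ρ / 2 := min_le_left _ _
  have hrℓ : r ≤ ℓ / (8 * C ^ 2) := min_le_right _ _
  have hdr : ‖x - p‖ ≤ ‖x - xbar‖ := hp.2 xbar hxbar
  have hxb : x ∈ Metric.ball xbar ρ := by rw [mem_ball_iff_norm]; linarith [h.radius_pos]
  have hpx : ‖p - xbar‖ ≤ 2 * r := by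
    have := norm_sub_le_norm_sub_add_norm_sub p x xbar
    rw [norm_sub_rev p x] at this
    linarith
  have hpb : p ∈ Metric.ball xbar ρ := by
    rw [mem_ball_iff_norm]
    have := norm_sub_le_norm_sub_add_norm_sub p x xbar
    rw [norm_sub_rev p x] at this
    linarith [h.radius_pos]
  set u := x - p
  set d := ‖u‖
  have hd0 : 0 ≤ d := norm_nonneg _
  have hfp : ∀ i, f p = fi i p := fun i =>
    eq_of_mem_activeIndices (h.isGreatest p hpb) (activeIndices_eq_univ hp.1 ▸ mem_univ i)
  have hfx : ∀ i, fi i x ≤ f x := fun i => (h.isGreatest x hxb).2 ⟨i, rfl⟩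
  obtain ⟨c, hc0, hc1, hcA, rfl⟩ := exists_weights_of_mem_convexHull
    (clarkeSubdiff_subset_convexHull hs (h.eventually_isGreatest hxb) hv)
  -- Only active functions carry weight, so every increment that counts is `f x - f p`.
  have hlow : f x - f p - C * d ^ 2 ≤ ⟪∑ i, c i • ∇ (fi i) x, u⟫ := by
    simp only [sum_inner, real_inner_smul_left]
    calc f x - f p - C * d ^ 2 = ∑ i, c i * (f x - f p - C * d ^ 2) := by
          rw [← Finset.sum_mul, hc1, one_mul]
      _ ≤ _ := Finset.sum_le_sum fun i _ => by
        by_cases hi : c i = 0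
        · simp [hi]
        refine mul_le_mul_of_nonneg_left ?_ (hc0 i)
        have h1 := h.taylor x hxb p hpb i
        rw [← neg_sub x p, inner_neg_right, norm_neg] at h1
        rw [eq_of_mem_activeIndices (h.isGreatest x hxb) (hcA i hi), hfp i]
        linarith [(abs_le.1 h1).1, (abs_le.1 h1).2]
  obtain ⟨j, hj⟩ := Finite.exists_min fun i => fi i x
  have hspread : d ≤ C * (f x - fi j x) := by
    obtain ⟨p', hp', hxp'⟩ := h.metric_regular x hxb (f x - fi j x) fun i k => by
      rw [abs_le]
      constructor <;> linarith [hj i, hj k, hfx i, hfx k]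
    exact (hp.2 p' hp').trans hxp'
  have havg_low : -(3 * C * r * d) ≤ ∑ i, l i * (fi i x - fi i p) := by
    have h1 : ∑ i, l i * (⟪∇ (fi i) p, u⟫ - C * d ^ 2) ≤ ∑ i, l i * (fi i x - fi i p) :=
      Finset.sum_le_sum fun i _ => mul_le_mul_of_nonneg_left
        (by linarith [(abs_le.1 (h.taylor p hpb x hxb i)).1]) (hl i).le
    have h2 : ∑ i, l i * (⟪∇ (fi i) p, u⟫ - C * d ^ 2) =
        ⟪∑ i, l i • ∇ (fi i) p, u⟫ - C * d ^ 2 := by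
      simp only [mul_sub, Finset.sum_sub_distrib, ← Finset.sum_mul, hl1, one_mul, sum_inner,
        real_inner_smul_left]
    have h3 := norm_sum_smul_sub_le (fun i => (hl i).le) hl1 fun i =>
      h.lipschitz_gradient p hpb xbar h.center_mem i
    rw [hl0, sub_zero] at h3
    have h4 := (abs_le.1 (abs_real_inner_le_norm (∑ i, l i • ∇ (fi i) p) u)).1
    have h5 : ‖∑ i, l i • ∇ (fi i) p‖ * d ≤ C * (2 * r) * d := by
      gcongr
      exact h3.trans (by gcongr)
    have h6 : C * d ^ 2 ≤ C * r * d := by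
      rw [pow_two, ← mul_assoc]
      gcongr
      linarith
    linarith
  have havg_up : ∑ i, l i * (fi i x - fi i p) ≤ f x - f p - ℓ * (f x - fi j x) := by
    have h1 : ∑ i, l i * (f x - fi i x) ≥ l j * (f x - fi j x) :=
      Finset.single_le_sum (f := fun i => l i * (f x - fi i x))
        (fun i _ => mul_nonneg (hl i).le (sub_nonneg.2 (hfx i))) (Finset.mem_univ j)
    have h2 : ∑ i, l i * (fi i x - fi i p) = f x - f p - ∑ i, l i * (f x - fi i x) := by
      rw [eq_sub_iff_add_eq, ← Finset.sum_add_distrib]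
      calc _ = ∑ i, l i * (f x - f p) := Finset.sum_congr rfl fun i _ => by rw [hfp i]; ring
        _ = _ := by rw [← Finset.sum_mul, hl1, one_mul]
    have h3 : ℓ * (f x - fi j x) ≤ l j * (f x - fi j x) :=
      mul_le_mul_of_nonneg_right (hi₀ j) (sub_nonneg.2 (hfx j))
    linarith
  have hℓd : ℓ / C * d ≤ ℓ * (f x - fi j x) := by
    rw [div_mul_eq_mul_div, div_le_iff₀ hC]
    nlinarith
  have hrd : 4 * C * r * d ≤ ℓ / (2 * C) * d := by
    gcongr
    calc 4 * C * r ≤ 4 * C * (ℓ / (8 * C ^ 2)) := by gcongr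
      _ = ℓ / (2 * C) := by field_simp; norm_num
  have hCd : C * d ^ 2 ≤ C * r * d := by
    rw [pow_two, ← mul_assoc]
    gcongr
    linarith
  have hsplit : ℓ / C * d = ℓ / (2 * C) * d + ℓ / (2 * C) * d := by field_simp; norm_num
  linarith

theorem aimingCondition [FiniteDimensional ℝ E] (h : LocalEstimates f fi xbar ρ C)
    (hs : ∀ i, ContDiff ℝ 2 (fi i)) (hxbar : xbar ∈ activeManifold fi) {l : ι → ℝ}
    (hl : ∀ i, 0 < l i) (hl1 : ∑ i, l i = 1) (hl0 : ∑ i, l i • ∇ (fi i) xbar = 0) :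
    AimingCondition f (activeManifold fi) xbar := by
  obtain ⟨μ, hμ, hev⟩ := h.exists_aiming_bound hs hxbar hl hl1 hl0
  refine ⟨μ, hμ, ?_⟩
  filter_upwards [hev, h.eventually_existsUnique_isNearestPoint hs hxbar] with x hx hu
  refine ⟨hu, fun p hp v hv => le_trans ?_ (hx p hp v hv)⟩
  gcongr
  rw [← dist_eq_norm]
  exact Metric.infDist_le_dist_of_mem hp.1

/-- On the active manifold, the subgradients of `f` grow linearly away from `xbar`: the trapezoid
rule bounds the increment of `f` from `xbar` to `p` by half of the subgradient paired with
`p - xbar`, up to smaller order, and that increment is at least of quadratic order. -/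
theorem exists_le_norm_sum_smul_gradient (h : LocalEstimates f fi xbar ρ C)
    (hs : ∀ i, ContDiff ℝ 2 (fi i)) (hxbar : xbar ∈ activeManifold fi)
    (hgrow : GrowsQuadratically f xbar) {l : ι → ℝ} (hl1 : ∑ i, l i = 1)
    (hl0 : ∑ i, l i • ∇ (fi i) xbar = 0) :
    ∃ β : ℝ, 0 < β ∧ ∀ᶠ p in 𝓝 xbar, p ∈ activeManifold fi → ∀ c : ι → ℝ, (∀ i, 0 ≤ c i) →
      ∑ i, c i = 1 → β * ‖p - xbar‖ ≤ ‖∑ i, c i • ∇ (fi i) p‖ := by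
  have hC := h.const_pos
  obtain ⟨δ, hδ, hgr⟩ := hgrow
  obtain ⟨A, hA, hanti⟩ :=
    (h.affineIndependent xbar h.center_mem).exists_abs_le_norm_sum_smul
  set n : ℝ := (Fintype.card ι : ℝ)
  have hn : 0 ≤ n := Nat.cast_nonneg _
  set D := n * (A * (1 + C) * C)
  have hD : 0 ≤ D := by positivity
  have htrap := eventually_all.2 fun i =>
    trapezoid_gradient (hs i) xbar (by positivity : 0 < δ / 8)
  refine ⟨min 1 (δ / 2), by positivity, ?_⟩
  filter_upwards [hgr, htrap, Metric.ball_mem_nhds xbar h.radius_pos,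
    Metric.ball_mem_nhds xbar (by positivity : 0 < δ / (4 * (D + 1)))]
    with p hpg hpt hpb hpsmall hpM c hc0 hc1
  rw [mem_ball_iff_norm] at hpsmall
  by_contra! hlt
  set u := p - xbar
  set R := ‖u‖
  set w := ∑ i, c i • ∇ (fi i) p
  have hR0 : 0 ≤ R := norm_nonneg _
  have hwR : ‖w‖ ≤ R := hlt.le.trans (mul_le_of_le_one_left hR0 (min_le_left _ _))
  set s := f p - f xbar
  have hsi : ∀ i, fi i p - fi i xbar = s := fun i => by
    simp only [s]
    rw [eq_of_mem_activeIndices (h.isGreatest p hpb) (activeIndices_eq_univ hpM ▸ mem_univ i),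
      eq_of_mem_activeIndices (h.isGreatest xbar h.center_mem)
        (activeIndices_eq_univ hxbar ▸ mem_univ i)]
  -- The weights `c` are within `O(R)` of the weights `l`.
  have hcl : ∀ i, |c i - l i| ≤ A * (1 + C) * R := fun i => by
    have h1 := hanti (fun i => c i - l i) (by rw [Finset.sum_sub_distrib, hc1, hl1, sub_self]) i
    simp only [sub_smul, Finset.sum_sub_distrib, hl0, sub_zero] at h1
    have h2 := norm_sum_smul_sub_le hc0 hc1 fun i =>
      h.lipschitz_gradient p hpb xbar h.center_mem i
    have h3 : ‖∑ i, c i • ∇ (fi i) xbar‖ ≤ (1 + C) * R := by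
      have := norm_sub_norm_le (∑ i, c i • ∇ (fi i) xbar) w
      rw [norm_sub_rev] at this
      linarith
    calc _ ≤ _ := h1
      _ ≤ A * ((1 + C) * R) := by gcongr
      _ = _ := by ring
  have hbase : ⟪∑ i, c i • ∇ (fi i) xbar, u⟫ ≤ D * R * R ^ 2 := by
    have h1 : ⟪∑ i, c i • ∇ (fi i) xbar, u⟫ =
        ∑ i, (c i - l i) * (⟪∇ (fi i) xbar, u⟫ - s) := by
      have e1 : ⟪∑ i, l i • ∇ (fi i) xbar, u⟫ = 0 := by rw [hl0, inner_zero_left]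
      simp only [sum_inner, real_inner_smul_left] at e1 ⊢
      simp only [mul_sub, sub_mul, Finset.sum_sub_distrib, ← Finset.sum_mul, e1, hc1, hl1]
      ring
    rw [h1]
    calc _ ≤ ∑ _i : ι, A * (1 + C) * R * (C * R ^ 2) := Finset.sum_le_sum fun i _ => by
          refine (le_abs_self _).trans ?_
          rw [abs_mul]
          gcongr
          · exact hcl i
          · have := h.taylor xbar h.center_mem p hpb i
            rwa [hsi i, abs_sub_comm] at this
      _ = D * R * R ^ 2 := by
        rw [Finset.sum_const, Finset.card_univ, nsmul_eq_mul]
        ring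
  have hs_le : s ≤ 1 / 2 * (‖w‖ * R) + 1 / 2 * (D * R * R ^ 2) + δ / 8 * R ^ 2 := by
    have h1 : s = ∑ i, c i * (fi i p - fi i xbar) := by
      simp only [hsi, ← Finset.sum_mul, hc1, one_mul]
    have h2 : ∑ i, c i * (fi i p - fi i xbar) ≤
        ∑ i, c i * (1 / 2 * ⟪∇ (fi i) p + ∇ (fi i) xbar, u⟫ + δ / 8 * R ^ 2) :=
      Finset.sum_le_sum fun i _ => mul_le_mul_of_nonneg_left
        (by linarith [(abs_le.1 (hpt i)).2]) (hc0 i)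
    have h3 : ∑ i, c i * (1 / 2 * ⟪∇ (fi i) p + ∇ (fi i) xbar, u⟫ + δ / 8 * R ^ 2) =
        1 / 2 * ⟪w, u⟫ + 1 / 2 * ⟪∑ i, c i • ∇ (fi i) xbar, u⟫ + δ / 8 * R ^ 2 := by
      simp only [w, sum_inner, real_inner_smul_left, Finset.mul_sum]
      have e : δ / 8 * R ^ 2 = ∑ i, c i * (δ / 8 * R ^ 2) := by
        rw [← Finset.sum_mul, hc1, one_mul]
      conv_rhs => rw [e, ← Finset.sum_add_distrib, ← Finset.sum_add_distrib]
      refine Finset.sum_congr rfl fun i _ => ?_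
      rw [inner_add_left]
      ring
    have h4 := real_inner_le_norm w u
    linarith
  have hDR : D * R * R ^ 2 ≤ δ / 4 * R ^ 2 := by
    gcongr
    rw [lt_div_iff₀ (by positivity)] at hpsmall
    nlinarith
  have hRpos : 0 < R := by
    by_contra hneg
    have : R = 0 := le_antisymm (not_lt.1 hneg) hR0
    rw [this, mul_zero] at hlt
    exact absurd hlt (not_lt.2 (norm_nonneg _))
  have hw2 : ‖w‖ < δ / 2 * R := hlt.trans_le (by gcongr; exact min_le_right _ _)
  have hw3 : ‖w‖ * R < δ / 2 * R * R := by gcongr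
  linarith

theorem goldsteinSubdiff_subset_approxHull (h : LocalEstimates f fi xbar ρ C)
    (hs : ∀ i, ContDiff ℝ 2 (fi i)) {x : E} {ε : ℝ} (hx : x ∈ Metric.ball xbar ρ)
    (hε : Metric.closedBall x ε ⊆ Metric.ball xbar ρ) :
    goldsteinSubdiff f ε x ⊆ approxHull (fun i => ∇ (fi i) x)
      {i | ∃ z ∈ Metric.closedBall x ε, i ∈ activeIndices fi z} (C * ε) := by
  have hC := h.const_pos
  refine convexHull_min (iUnion₂_subset fun z hz => ?_) (convex_approxHull _ _ _)
  refine (clarkeSubdiff_subset_convexHull hs (h.eventually_isGreatest (hε hz))).trans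
    (convexHull_min ?_ (convex_approxHull _ _ _))
  rintro _ ⟨i, hi, rfl⟩
  refine mem_approxHull_of_norm_sub_le ⟨z, hz, hi⟩
    ((h.lipschitz_gradient z (hε hz) x hx i).trans ?_)
  gcongr
  rwa [← dist_eq_norm]

/-- An element of `∂_ε f(x)` of norm at most `ε` forces `‖x - xbar‖` to be at most a multiple of
`ε`: it is close to a convex combination of the `∇ (fi i) x` whose weights are close to those
producing `0` at `xbar`, hence positive; thus all indices are active within `ε` of `x`, so that `x`
is within `O(ε)` of a point of the active manifold with a subgradient of size `O(ε)`. -/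
theorem exists_mul_norm_sub_le (h : LocalEstimates f fi xbar ρ C)
    (hs : ∀ i, ContDiff ℝ 2 (fi i)) (hxbar : xbar ∈ activeManifold fi)
    (hgrow : GrowsQuadratically f xbar) {l : ι → ℝ} (hl : ∀ i, 0 < l i) (hl1 : ∑ i, l i = 1)
    (hl0 : ∑ i, l i • ∇ (fi i) xbar = 0) :
    ∃ α : ℝ, 0 < α ∧ ∀ᶠ x in 𝓝 xbar, ∀ ε : ℝ, 0 ≤ ε → ∀ v ∈ goldsteinSubdiff f ε x, ‖v‖ ≤ ε →
      α * ‖x - xbar‖ ≤ ε := by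
  have hC := h.const_pos
  have hne : Nonempty ι :=
    (exists_mem_activeIndices (h.isGreatest xbar h.center_mem)).nonempty
  obtain ⟨i₀, hi₀⟩ := Finite.exists_min l
  set ℓ := l i₀
  have hℓ : 0 < ℓ := hl i₀
  obtain ⟨A, hA, hanti⟩ :=
    (h.affineIndependent xbar h.center_mem).exists_abs_le_norm_sum_smul
  obtain ⟨β, hβ, hev⟩ := h.exists_le_norm_sum_smul_gradient hs hxbar hgrow hl1 hl0
  obtain ⟨ρ', hρ', hball⟩ := Metric.eventually_nhds_iff_ball.1 hev
  set Q := 2 * C ^ 2 + (C + 1 + 2 * C ^ 3) / β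
  have hQ : 0 < Q := by positivity
  have hρ := h.radius_pos
  refine ⟨min 1 (1 / Q), by positivity, ?_⟩
  -- The radii keep `p` and the `ε`-ball around `x` in the ball of radius `ρ`, keep `p` in the ball
  -- of radius `ρ'`, and make the weights `c` closer to `l` than the least weight `ℓ`.
  filter_upwards [Metric.ball_mem_nhds xbar (by positivity : 0 < ρ / (2 * (1 + C ^ 2))),
    Metric.ball_mem_nhds xbar (by positivity : 0 < ρ' / (1 + 2 * C ^ 2)),
    Metric.ball_mem_nhds xbar (by positivity : 0 < ℓ / (A * (2 * C + 1)))]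
    with x hx1 hx2 hx3 ε hε v hv hvε
  rw [mem_ball_iff_norm, lt_div_iff₀ (by positivity)] at hx1 hx2 hx3
  set R := ‖x - xbar‖
  have hR0 : 0 ≤ R := norm_nonneg _
  rcases le_or_gt R ε with hRε | hεR
  · exact (mul_le_of_le_one_left hR0 (min_le_left _ _)).trans hRε
  have hR2 : 2 * R + 2 * C ^ 2 * R < ρ := by linarith
  have hCR : 0 ≤ C ^ 2 * R := by positivity
  have hxb : x ∈ Metric.ball xbar ρ := by rw [mem_ball_iff_norm]; linarith
  have hcb : Metric.closedBall x ε ⊆ Metric.ball xbar ρ := fun z hz => by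
    rw [mem_closedBall_iff_norm] at hz
    rw [mem_ball_iff_norm]
    have := norm_sub_le_norm_sub_add_norm_sub z x xbar
    linarith
  obtain ⟨c, hc0, hc1, hcA, hcv⟩ := h.goldsteinSubdiff_subset_approxHull hs hxb hcb hv
  have hcx : ‖∑ i, c i • ∇ (fi i) x‖ ≤ (C + 1) * ε := by
    have := norm_sub_norm_le (∑ i, c i • ∇ (fi i) x) v
    rw [norm_sub_rev] at this
    linarith
  have hcbar : ‖∑ i, c i • ∇ (fi i) xbar‖ ≤ (2 * C + 1) * R := by
    have h1 := norm_sum_smul_sub_le hc0 hc1 fun i =>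
      h.lipschitz_gradient x hxb xbar h.center_mem i
    have h2 := norm_sub_norm_le (∑ i, c i • ∇ (fi i) xbar) (∑ i, c i • ∇ (fi i) x)
    rw [norm_sub_rev] at h2
    have h3 : (C + 1) * ε ≤ (C + 1) * R := by gcongr
    linarith
  -- Hence every function is active within `ε` of `x`, which bounds the spread of the values at `x`.
  have hcpos : ∀ i, c i ≠ 0 := fun i hi => by
    have h1 := hanti (fun i => c i - l i) (by rw [Finset.sum_sub_distrib, hc1, hl1, sub_self]) i
    simp only [sub_smul, Finset.sum_sub_distrib, hl0, sub_zero, hi, zero_sub, abs_neg] at h1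
    rw [abs_of_pos (hl i)] at h1
    have h2 : A * ‖∑ i, c i • ∇ (fi i) xbar‖ ≤ A * ((2 * C + 1) * R) := by gcongr
    linarith [hi₀ i]
  have hvals : ∀ i j, fi j x - fi i x ≤ 2 * C * ε := fun i j => by
    obtain ⟨z, hz, hzi⟩ := hcA i (hcpos i)
    have hxz : C * ‖x - z‖ ≤ C * ε := by
      gcongr
      rwa [← dist_eq_norm, dist_comm]
    have h1 := (abs_le.1 (h.lipschitz x hxb z (hcb hz) i)).1
    have h2 := (abs_le.1 (h.lipschitz x hxb z (hcb hz) j)).2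
    linarith [hzi j]
  obtain ⟨p, hpM, hxp⟩ := h.metric_regular x hxb (2 * C * ε) fun i j => by
    rw [abs_le]
    constructor <;> linarith [hvals i j, hvals j i]
  have hxp' : ‖x - p‖ ≤ 2 * C ^ 2 * ε := hxp.trans_eq (by ring)
  have hpx : ‖p - xbar‖ ≤ (1 + 2 * C ^ 2) * R := by
    have h1 := norm_sub_le_norm_sub_add_norm_sub p x xbar
    rw [norm_sub_rev p x] at h1
    have h2 : 2 * C ^ 2 * ε ≤ 2 * C ^ 2 * R := by gcongr
    linarith
  have hpb : p ∈ Metric.ball xbar ρ := by rw [mem_ball_iff_norm]; linarith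
  have hpβ := hball p (by rw [mem_ball_iff_norm]; linarith) hpM c hc0 hc1
  have hcp : ‖∑ i, c i • ∇ (fi i) p‖ ≤ (C + 1 + 2 * C ^ 3) * ε := by
    have h1 := norm_sum_smul_sub_le hc0 hc1 fun i => h.lipschitz_gradient x hxb p hpb i
    have h2 := norm_sub_norm_le (∑ i, c i • ∇ (fi i) p) (∑ i, c i • ∇ (fi i) x)
    rw [norm_sub_rev] at h2
    have h3 : C * ‖x - p‖ ≤ C * (2 * C ^ 2 * ε) := by gcongr
    linarith
  have hpε : ‖p - xbar‖ ≤ (C + 1 + 2 * C ^ 3) / β * ε := by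
    rw [div_mul_eq_mul_div, le_div_iff₀ hβ]
    linarith
  have hRQ : R ≤ Q * ε := by
    have h1 := norm_sub_le_norm_sub_add_norm_sub x p xbar
    simp only [Q, add_mul]
    linarith
  calc min 1 (1 / Q) * R ≤ 1 / Q * R := by gcongr; exact min_le_right _ _
    _ ≤ 1 / Q * (Q * ε) := by gcongr
    _ = ε := by field_simp

end LocalEstimates

theorem goldsteinModulusGrowsLinearly_of_forall {E : Type*} [NormedAddCommGroup E]
    [InnerProductSpace ℝ E] [CompleteSpace E] {f : E → ℝ} {xbar : E}
    (hcrit : (0 : E) ∈ clarkeSubdiff f xbar)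
    (hα : ∃ α : ℝ, 0 < α ∧ ∀ᶠ x in 𝓝 xbar, ∀ ε : ℝ, 0 ≤ ε → ∀ v ∈ goldsteinSubdiff f ε x,
      ‖v‖ ≤ ε → α * ‖x - xbar‖ ≤ ε) :
    GoldsteinModulusGrowsLinearly f xbar := by
  obtain ⟨α, hα, hev⟩ := hα
  refine ⟨α, hα, hev.mono fun x hx => le_csInf ?_ ?_⟩
  · -- The infimum is over a nonempty set: `0` is a subgradient at `xbar`, at distance `‖x - xbar‖`.
    refine ⟨‖x - xbar‖, norm_nonneg _, 0, ⟨?_, fun v _ => by simp⟩, by simp⟩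
    refine subset_convexHull ℝ _ (mem_iUnion₂.2 ⟨xbar, ?_, hcrit⟩)
    rw [Metric.mem_closedBall, dist_comm, dist_eq_norm]
  · rintro ε ⟨hε, g, hg, hgε⟩
    exact hx ε hε g hg.1 hgε

theorem mainTheorem4 {E : Type*} [NormedAddCommGroup E] [InnerProductSpace ℝ E]
    [FiniteDimensional ℝ E] [CompleteSpace E] {ι : Type*}
    (f : E → ℝ) (fi : ι → E → ℝ) (xbar : E) (hf : IsStrongC2Max f fi xbar) :
    GrowsRobustly f (activeManifold fi) xbar ∧ GoldsteinModulusGrowsLinearly f xbar := by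
  have := hf.finite
  cases nonempty_fintype ι
  obtain ⟨ρ, C, h⟩ := exists_localEstimates hf
  have hs := hf.smooth
  have hxbar : xbar ∈ activeManifold fi := hf.values_eq
  obtain ⟨i₀, -, -⟩ := exists_mem_activeIndices hf.eq_max.self_of_nhds
  have : Nonempty ι := ⟨i₀⟩
  obtain ⟨l, hl, hl1, hl0⟩ := hf.affineIndependent.exists_pos_weights (by
    have hri := hf.nondegenerate
    rwa [clarkeSubdiff_eq_convexHull hs hf.eq_max hf.affineIndependent,
      activeIndices_eq_univ hxbar, image_univ] at hri)
  have hball := Metric.ball_mem_nhds xbar h.radius_pos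
  refine ⟨⟨isC2ManifoldAround_activeManifold hs hf.affineIndependent hxbar,
    ⟨C.toNNReal, _, hball, h.lipschitzOnWith⟩, hf.quadratic_growth, ?_, ?_,
    h.subdiffUpperLipschitz hs, h.aimingCondition hs hxbar hl hl1 hl0⟩,
    goldsteinModulusGrowsLinearly_of_forall (intrinsicInterior_subset hf.nondegenerate)
      (h.exists_mul_norm_sub_le hs hxbar hf.quadratic_growth hl hl1 hl0)⟩
  · filter_upwards [self_mem_nhdsWithin, nhdsWithin_le_nhds hball] with x hxM hx
    exact subdiffRegularAt_of_mem_activeManifold hs (h.eventually_isGreatest hx)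
      (h.affineIndependent x hx) hxM
  · refine ⟨fi i₀, (hs i₀).contDiffAt, ?_⟩
    filter_upwards [self_mem_nhdsWithin, nhdsWithin_le_nhds hball] with x hxM hx
    exact eq_of_mem_activeIndices (h.isGreatest x hx) (activeIndices_eq_univ hxM ▸ mem_univ i₀)
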